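/- Fix a first-order modal language without equality, constants or function symbols, with predicate symbols $P_0,P_1,P_2,\dots$, variables $x_0,x_1,x_2,\dots$, and a computable arity function, such that infinitely many predicate symbols are unary and at least two are binary. The formulas of first-order modal logic (FOML) are $$\alpha ::= P(y_1,\dots,y_n)\mid \neg\alpha\mid \alpha\wedge\alpha\mid \exists x\,\alpha\mid \Box\alpha ,$$ where $P$ has arity $n$ and $x,y_1,\dots,y_n$ are variables, and $\forall x\,\alpha$ abbreviates $\neg\exists x\,\neg\alpha$. The fragment EBBA is the set of formulas given by $$\alpha ::= P(y_1,\dots,y_n)\mid \neg\alpha\mid \alpha\wedge\alpha\mid \Box\alpha\mid \exists x\,\Box\alpha\mid \Box\forall x\,\alpha .$$ An increasing-domain model consists of a nonempty countable set $W$ of worlds, a nonempty countable set $D$, a relation $R\subseteq W\times W$, for each $w\in W$ a nonempty local domain $\delta(w)\subseteq D$ such that $\delta(w)\subseteq\delta(v)$ whenever $(w,v)\in R$, and for each $w\in W$ and each predicate symbol $P$ of arity $n$ a set $\rho(w,P)\subseteq\delta(w)^n$. Truth at a world $w$ under an assignment $\sigma$ of elements of $\delta(w)$ to the variables is defined as usual: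 $P(y_1,\dots,y_n)$ holds iff $(\sigma(y_1),\dots,\sigma(y_n))\in\rho(w,P)$, $\exists x$ ranges over $\delta(w)$, and $\Box\alpha$ holds iff $\alpha$ holds under $\sigma$ at every $u$ with $(w,u)\in R$. A formula is satisfiable if it is true at some world $w$ of some increasing-domain model under some assignment with values in $\delta(w)$. Let $\mathcal L$ be any set of FOML formulas with $\mathrm{EBBA}\subseteq\mathcal L$. Then the satisfiability problem for $\mathcal L$ over increasing-domain models is undecidable: there is no algorithm that, given (the Gödel number of) any formula $\varphi\in\mathcal L$, halts and correctly answers whether $\varphi$ is satisfiable. (Nothing is required of the algorithm on inputs outside $\mathcal L$.) -/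

import Mathlib

namespace FOML

/-- Formulas of first-order modal logic (no equality, constants or function symbols).
The predicate symbols are the natural numbers, `arity P` is the arity of the symbol `P`, and the
variables are the natural numbers. -/
inductive Formula (arity : ℕ → ℕ) : Type
  | atom (P : ℕ) (xs : Fin (arity P) → ℕ) : Formula arity
  | neg (φ : Formula arity) : Formula arity
  | and (φ ψ : Formula arity) : Formula arity
  | ex (x : ℕ) (φ : Formula arity) : Formula arity
  | box (φ : Formula arity) : Formula arity

namespace Formula

variable {arity : ℕ → ℕ}

/-- The defined quantifier `∀ x φ := ¬ ∃ x ¬ φ`. -/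
abbrev all (x : ℕ) (φ : Formula arity) : Formula arity :=
  neg (ex x (neg φ))

/-- A Gödel numbering of the formulas: the first component of the pair is the outermost
constructor. -/
def code : Formula arity → ℕ
  | atom P xs => Nat.pair 0 (Nat.pair P (Encodable.encode (List.ofFn xs)))
  | neg φ => Nat.pair 1 φ.code
  | and φ ψ => Nat.pair 2 (Nat.pair φ.code ψ.code)
  | ex x φ => Nat.pair 3 (Nat.pair x φ.code)
  | box φ => Nat.pair 4 φ.code

/-- Distinct formulas have distinct Gödel numbers. -/
theorem code_injective : Function.Injective (code : Formula arity → ℕ) := by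
  intro φ
  induction φ with
  | atom P xs =>
    intro ψ h
    cases ψ with
    | atom P' xs' =>
      simp only [code, Nat.pair_eq_pair, true_and] at h
      obtain ⟨rfl, h⟩ := h
      rw [List.ofFn_injective (Encodable.encode_injective h)]
    | _ => simp [code, Nat.pair_eq_pair] at h
  | neg φ ih =>
    intro ψ h
    cases ψ with
    | neg ψ =>
      simp only [code, Nat.pair_eq_pair, true_and] at h
      rw [ih h]
    | _ => simp [code, Nat.pair_eq_pair] at h
  | and φ₁ φ₂ ih₁ ih₂ =>
    intro ψ h
    cases ψ with
    | and ψ₁ ψ₂ =>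
      simp only [code, Nat.pair_eq_pair, true_and] at h
      rw [ih₁ h.1, ih₂ h.2]
    | _ => simp [code, Nat.pair_eq_pair] at h
  | ex x φ ih =>
    intro ψ h
    cases ψ with
    | ex y ψ =>
      simp only [code, Nat.pair_eq_pair, true_and] at h
      rw [h.1, ih h.2]
    | _ => simp [code, Nat.pair_eq_pair] at h
  | box φ ih =>
    intro ψ h
    cases ψ with
    | box ψ =>
      simp only [code, Nat.pair_eq_pair, true_and] at h
      rw [ih h]
    | _ => simp [code, Nat.pair_eq_pair] at h

end Formula

/-- Increasing domain models. -/
structure Model (arity : ℕ → ℕ) where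
  /-- the worlds -/
  World : Type
  /-- the global domain -/
  Dom : Type
  world_countable : Countable World
  world_nonempty : Nonempty World
  dom_countable : Countable Dom
  dom_nonempty : Nonempty Dom
  /-- the local domains -/
  δ : World → Set Dom
  /-- the accessibility relation -/
  R : World → World → Prop
  /-- the valuation -/
  ρ : World → (P : ℕ) → Set (Fin (arity P) → Dom)
  δ_nonempty : ∀ w, (δ w).Nonempty
  δ_mono : ∀ w v, R w v → δ w ⊆ δ v
  /-- predicates are interpreted over the local domain -/
  ρ_local : ∀ w P, ∀ a ∈ ρ w P, ∀ i, a i ∈ δ w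

/-- An assignment is relevant at `w` if all its values lie in the local domain of `w`. -/
def Model.Relevant {arity : ℕ → ℕ} (M : Model arity) (w : M.World) (σ : ℕ → M.Dom) : Prop :=
  ∀ x, σ x ∈ M.δ w

/-- Truth of a formula at a world under an assignment. -/
def Model.Sat {arity : ℕ → ℕ} (M : Model arity) :
    M.World → (ℕ → M.Dom) → Formula arity → Prop
  | w, σ, .atom P xs => (fun i => σ (xs i)) ∈ M.ρ w P
  | w, σ, .neg φ => ¬ M.Sat w σ φ
  | w, σ, .and φ ψ => M.Sat w σ φ ∧ M.Sat w σ ψ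
  | w, σ, .ex x φ => ∃ d ∈ M.δ w, M.Sat w (Function.update σ x d) φ
  | w, σ, .box φ => ∀ u, M.R w u → M.Sat u σ φ

/-- Satisfiability over increasing domain models. -/
def Satisfiable {arity : ℕ → ℕ} (φ : Formula arity) : Prop :=
  ∃ (M : Model arity) (w : M.World) (σ : ℕ → M.Dom), M.Relevant w σ ∧ M.Sat w σ φ

/-- Membership in the fragment `EBBA`: atomic formulas, negation, conjunction, `□`, and the
bundles `∃ x □` and `□ ∀ x`. -/
inductive IsEBBA {arity : ℕ → ℕ} : Formula arity → Prop
  | atom (P : ℕ) (xs : Fin (arity P) → ℕ) : IsEBBA (.atom P xs)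
  | neg {φ : Formula arity} : IsEBBA φ → IsEBBA (.neg φ)
  | and {φ ψ : Formula arity} : IsEBBA φ → IsEBBA ψ → IsEBBA (.and φ ψ)
  | box {φ : Formula arity} : IsEBBA φ → IsEBBA (.box φ)
  | exBox (x : ℕ) {φ : Formula arity} : IsEBBA φ → IsEBBA (.ex x (.box φ))
  | boxAll (x : ℕ) {φ : Formula arity} : IsEBBA φ → IsEBBA (.box (.all x φ))

/-- The fragment `EBBA`. -/
def EBBA (arity : ℕ → ℕ) : Set (Formula arity) := {φ | IsEBBA φ}

/-- The satisfiability problem for the set `L` of formulas is decidable: some algorithm halts on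
(the Gödel number of) every formula in `L` and answers correctly whether it is satisfiable.
Nothing is required of the algorithm on other inputs, so a decision procedure for the set of
satisfiable formulas of `L` is in particular such an algorithm, and `L` need not be a decidable
set. -/
def SatProblemDecidable {arity : ℕ → ℕ} (L : Set (Formula arity)) : Prop :=
  ∃ f : ℕ →. Bool, Partrec f ∧
    ∀ φ ∈ L, ∃ b ∈ f φ.code, (b = true ↔ Satisfiable φ)

end FOML

/-!
The halting problem reduces to non-satisfiability of `EBBA` formulas over one binary predicate
symbol `P`.

Given a world `v`, read `□ⁱ P(x, y)` at `v` as an atom `Bᵢ(x, y)`; one binary symbol thus provides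
infinitely many independent binary relations (`Model.rels`). With increasing domains, the elements
of the local domain of a world `u` remain available at all later worlds, so the bundles can state
the following about `u` and the worlds `v` at a fixed distance from `u`:

* each element of `δ(u)` has a `B₀`-successor in `δ(u)`, by a formula `□∀x∃y□…□ P(x, y)`
  (`totality`);
* each clause of a given universal Horn program in the `Bᵢ` is true at `v` for all elements of
  `δ(u)`, by a prefix `□∀xₖ … □∀x₁□` (`alls`).

Free variables `x₀, …, xₙ` linked by `B₀` name the numbers `0, …, n`, so the query
`¬ Bᵣ(n, 0)` is expressible as well. Such a conjunction (`translation`) is satisfiable if and only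
if the program has a model on `ℕ` in which `B₀` contains the graph of the successor function and
the query holds: pulling the relations back along a sequence of successors gives one direction
(`exists_isHornModel_of_satisfiable`), a single path of worlds with constant domain `ℕ` the other
(`satisfiable_of_isHornModel`).

For each `c : Nat.Partrec.Code` there is a Horn program deriving the graph of `c.eval`
(`evalClauses`), with auxiliary relations for the order and for `Nat.unpair` (`arithClauses`). The
true relations are a model of it (`isHornModel_standard`), and every model contains them
(`IsHornModel.eval`). Hence the translation for `c` and `n` is satisfiable if and only if
`0 ∉ c.eval n`. A fixed `c` for which `0 ∈ c.eval n` expresses that the program coded by `n` halts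
gives the reduction, and the Gödel number of the translation is primitive recursive in `n`
(`primrec_code_translation`).
-/

namespace FOML

open Nat.Partrec (Code)

namespace Formula

variable {arity : ℕ → ℕ}

/-- The atomic formula `P(x, y)` for a binary symbol `P`. The type of argument tuples is
`Fin (arity P) → ℕ`, where `arity P = 2` is only known propositionally; the case distinction on the
position avoids a cast. -/
def binAtom (P x y : ℕ) : Formula arity :=
  .atom P fun i => if i.val = 0 then x else y

/-- Implication. -/
def imp (φ ψ : Formula arity) : Formula arity :=
  neg (and φ (neg ψ))

/-- `alls k φ` is `□∀xₖ … □∀x₁ □ φ`. The variable `x₀` is not bound. -/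
def alls : ℕ → Formula arity → Formula arity
  | 0, φ => box φ
  | k + 1, φ => box (all (k + 1) (alls k φ))

theorem isEBBA_binAtom (P x y : ℕ) : IsEBBA (binAtom P x y : Formula arity) :=
  .atom _ _

theorem _root_.FOML.IsEBBA.imp {φ ψ : Formula arity} (hφ : IsEBBA φ) (hψ : IsEBBA ψ) :
    IsEBBA (imp φ ψ) :=
  .neg (.and hφ (.neg hψ))

theorem _root_.FOML.IsEBBA.boxes {φ : Formula arity} (hφ : IsEBBA φ) (n : ℕ) :
    IsEBBA (box^[n] φ) := by
  induction n with
  | zero => exact hφ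
  | succ n ih =>
    rw [Function.iterate_succ_apply']
    exact .box ih

theorem _root_.FOML.IsEBBA.alls {φ : Formula arity} (hφ : IsEBBA φ) (k : ℕ) :
    IsEBBA (alls k φ) := by
  induction k with
  | zero => exact .box hφ
  | succ k ih => exact .boxAll _ ih

end Formula

open Formula

/-! ### Horn programs -/

/-- An atom `Bᵢ(x, y)` in the variables `x₀, …, xₖ`, where `B₀, B₁, …` are binary relations. -/
structure HornAtom (k : ℕ) where
  /-- the index of the relation -/
  rel : ℕ
  /-- the first variable -/
  fst : Fin (k + 1)
  /-- the second variable -/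
  snd : Fin (k + 1)

/-- A definite Horn clause, read as universally quantified over `x₁, …, xₖ`; the variable `x₀`
serves as a constant for the number zero. -/
structure HornClause (k : ℕ) where
  /-- the premises -/
  body : List (HornAtom k)
  /-- the conclusion -/
  head : HornAtom k

variable {k : ℕ} {D : Type}

/-- Truth of an atom under an assignment. -/
def HornAtom.Holds (B : ℕ → D → D → Prop) (ν : Fin (k + 1) → D) (a : HornAtom k) : Prop :=
  B a.rel (ν a.fst) (ν a.snd)

/-- Truth of a clause under an assignment. -/
def HornClause.Holds (B : ℕ → D → D → Prop) (ν : Fin (k + 1) → D) (C : HornClause k) : Prop :=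
  (∀ a ∈ C.body, a.Holds B ν) → C.head.Holds B ν

/-- A family of relations on `ℕ` is a model of a program if its relation of index `0` contains the
graph of the successor function and all clauses hold with `x₀` denoting zero. -/
structure IsHornModel (Γ : List (HornClause k)) (B : ℕ → ℕ → ℕ → Prop) : Prop where
  succ : ∀ a, B 0 a (a + 1)
  clauses : ∀ C ∈ Γ, ∀ ν : Fin (k + 1) → ℕ, ν 0 = 0 → C.Holds B ν

theorem IsHornModel.mono {Γ Δ : List (HornClause k)} {B : ℕ → ℕ → ℕ → Prop}
    (h : IsHornModel Δ B) (hs : Γ ⊆ Δ) : IsHornModel Γ B :=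
  ⟨h.succ, fun C hC => h.clauses C (hs hC)⟩

/-! ### A Horn program evaluating partial recursive functions -/

/-- Index of the successor relation. -/
abbrev succRel : ℕ := 0

/-- Index of the strict order. -/
abbrev ltRel : ℕ := 1

/-- Index of the graph of the first projection of `Nat.unpair`. -/
abbrev fstRel : ℕ := 2

/-- Index of the graph of the second projection of `Nat.unpair`. -/
abbrev sndRel : ℕ := 3

/-- Index of the graph of the partial function computed by `c`. -/
abbrev evalRel (c : Code) : ℕ := Encodable.encode c + 4

/-- The intended interpretation of the relation symbols. -/
def standard : ℕ → ℕ → ℕ → Prop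
  | 0, a, b => b = a + 1
  | 1, a, b => a < b
  | 2, a, b => b = a.unpair.1
  | 3, a, b => b = a.unpair.2
  | i + 4, a, b => b ∈ (Denumerable.ofNat Code i).eval a

@[simp] theorem standard_succ (a b : ℕ) : standard succRel a b ↔ b = a + 1 := Iff.rfl

@[simp] theorem standard_lt (a b : ℕ) : standard ltRel a b ↔ a < b := Iff.rfl

@[simp] theorem standard_fst (a b : ℕ) : standard fstRel a b ↔ b = a.unpair.1 := Iff.rfl

@[simp] theorem standard_snd (a b : ℕ) : standard sndRel a b ↔ b = a.unpair.2 := Iff.rfl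

@[simp] theorem standard_eval (c : Code) (a b : ℕ) :
    standard (evalRel c) a b ↔ b ∈ c.eval a := by
  simp [standard]

/-- Clauses for the order and for unpairing. The latter compute `Nat.unpair (e + 1)` from
`Nat.unpair e = (a, b)`, distinguishing the cases `a + 1 < b`, `a + 1 = b`, `b < a` and `a = b`. -/
def arithClauses : List (HornClause 9) :=
  [⟨[⟨succRel, 1, 2⟩], ⟨ltRel, 1, 2⟩⟩,
   ⟨[⟨ltRel, 1, 2⟩, ⟨succRel, 2, 3⟩], ⟨ltRel, 1, 3⟩⟩,
   ⟨[], ⟨fstRel, 0, 0⟩⟩,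
   ⟨[], ⟨sndRel, 0, 0⟩⟩,
   ⟨[⟨succRel, 1, 2⟩, ⟨fstRel, 1, 3⟩, ⟨sndRel, 1, 4⟩, ⟨succRel, 3, 5⟩, ⟨ltRel, 5, 4⟩],
    ⟨fstRel, 2, 5⟩⟩,
   ⟨[⟨succRel, 1, 2⟩, ⟨fstRel, 1, 3⟩, ⟨sndRel, 1, 4⟩, ⟨succRel, 3, 5⟩, ⟨ltRel, 5, 4⟩],
    ⟨sndRel, 2, 4⟩⟩,
   ⟨[⟨succRel, 1, 2⟩, ⟨fstRel, 1, 3⟩, ⟨sndRel, 1, 4⟩, ⟨succRel, 3, 4⟩], ⟨fstRel, 2, 4⟩⟩,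
   ⟨[⟨succRel, 1, 2⟩, ⟨fstRel, 1, 3⟩, ⟨sndRel, 1, 4⟩, ⟨succRel, 3, 4⟩], ⟨sndRel, 2, 0⟩⟩,
   ⟨[⟨succRel, 1, 2⟩, ⟨fstRel, 1, 3⟩, ⟨sndRel, 1, 4⟩, ⟨ltRel, 4, 3⟩, ⟨succRel, 4, 5⟩],
    ⟨fstRel, 2, 3⟩⟩,
   ⟨[⟨succRel, 1, 2⟩, ⟨fstRel, 1, 3⟩, ⟨sndRel, 1, 4⟩, ⟨ltRel, 4, 3⟩, ⟨succRel, 4, 5⟩],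
    ⟨sndRel, 2, 5⟩⟩,
   ⟨[⟨succRel, 1, 2⟩, ⟨fstRel, 1, 3⟩, ⟨sndRel, 1, 3⟩, ⟨succRel, 3, 4⟩], ⟨fstRel, 2, 0⟩⟩,
   ⟨[⟨succRel, 1, 2⟩, ⟨fstRel, 1, 3⟩, ⟨sndRel, 1, 3⟩, ⟨succRel, 3, 4⟩], ⟨sndRel, 2, 4⟩⟩]

/-- Clauses deriving the graph of `Nat.Partrec.Code.eval` for a code and its subcodes. In each
conclusion `x₁` is the input and `x₂` the output. -/
def evalClauses : Code → List (HornClause 9)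
  | .zero => [⟨[], ⟨evalRel .zero, 1, 0⟩⟩]
  | .succ => [⟨[⟨succRel, 1, 2⟩], ⟨evalRel .succ, 1, 2⟩⟩]
  | .left => [⟨[⟨fstRel, 1, 2⟩], ⟨evalRel .left, 1, 2⟩⟩]
  | .right => [⟨[⟨sndRel, 1, 2⟩], ⟨evalRel .right, 1, 2⟩⟩]
  | .pair cf cg =>
    ⟨[⟨evalRel cf, 1, 3⟩, ⟨evalRel cg, 1, 4⟩, ⟨fstRel, 2, 3⟩, ⟨sndRel, 2, 4⟩],
      ⟨evalRel (.pair cf cg), 1, 2⟩⟩ :: (evalClauses cf ++ evalClauses cg)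
  | .comp cf cg =>
    ⟨[⟨evalRel cg, 1, 3⟩, ⟨evalRel cf, 3, 2⟩], ⟨evalRel (.comp cf cg), 1, 2⟩⟩ ::
      (evalClauses cf ++ evalClauses cg)
  | .prec cf cg =>
    ⟨[⟨fstRel, 1, 3⟩, ⟨sndRel, 1, 0⟩, ⟨evalRel cf, 3, 2⟩], ⟨evalRel (.prec cf cg), 1, 2⟩⟩ ::
    -- `x₁ = (x₃, x₅ + 1)`, `x₆ = (x₃, x₅)`, `x₇` is the value at `x₆`, and `x₉ = (x₃, (x₅, x₇))`
    ⟨[⟨fstRel, 1, 3⟩, ⟨sndRel, 1, 4⟩, ⟨succRel, 5, 4⟩, ⟨fstRel, 6, 3⟩, ⟨sndRel, 6, 5⟩,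
      ⟨evalRel (.prec cf cg), 6, 7⟩, ⟨fstRel, 8, 5⟩, ⟨sndRel, 8, 7⟩, ⟨fstRel, 9, 3⟩,
      ⟨sndRel, 9, 8⟩, ⟨evalRel cg, 9, 2⟩], ⟨evalRel (.prec cf cg), 1, 2⟩⟩ ::
      (evalClauses cf ++ evalClauses cg)
  | .rfind' cf =>
    ⟨[⟨sndRel, 1, 2⟩, ⟨evalRel cf, 1, 0⟩], ⟨evalRel (.rfind' cf), 1, 2⟩⟩ ::
    -- `x₁ = (x₃, x₄)` is not a zero of `cf`, so the search goes on at `x₈ = (x₃, x₄ + 1)`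
    ⟨[⟨fstRel, 1, 3⟩, ⟨sndRel, 1, 4⟩, ⟨evalRel cf, 1, 5⟩, ⟨succRel, 6, 5⟩, ⟨succRel, 4, 7⟩,
      ⟨fstRel, 8, 3⟩, ⟨sndRel, 8, 7⟩, ⟨evalRel (.rfind' cf), 8, 2⟩],
      ⟨evalRel (.rfind' cf), 1, 2⟩⟩ :: evalClauses cf

/-- The recursion by which `Nat.unpair` enumerates the pairs. -/
theorem unpair_add_one (e : ℕ) :
    (e + 1).unpair =
      if e.unpair.1 + 1 < e.unpair.2 then (e.unpair.1 + 1, e.unpair.2)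
      else if e.unpair.1 + 1 = e.unpair.2 then (e.unpair.2, 0)
      else if e.unpair.2 < e.unpair.1 then (e.unpair.1, e.unpair.2 + 1)
      else (0, e.unpair.1 + 1) := by
  obtain ⟨a, b, rfl⟩ : ∃ a b, e = Nat.pair a b := ⟨_, _, (Nat.pair_unpair e).symm⟩
  simp only [Nat.unpair_pair]
  have key : ∀ c d, Nat.pair a b + 1 = Nat.pair c d → (Nat.pair a b + 1).unpair = (c, d) :=
    fun c d h => by rw [h, Nat.unpair_pair]
  split_ifs with h₁ h₂ h₃
  · refine key _ _ ?_
    rw [Nat.pair, Nat.pair, if_pos h₁, if_pos (by omega)]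
    ring
  · subst h₂
    refine key _ _ ?_
    rw [Nat.pair, Nat.pair, if_pos (by omega), if_neg (by omega)]
    ring
  · refine key _ _ ?_
    rw [Nat.pair, Nat.pair, if_neg (by omega), if_neg (by omega)]
    ring
  · obtain rfl : a = b := by omega
    refine key _ _ ?_
    rw [Nat.pair, Nat.pair, if_neg (by omega), if_pos (by omega)]
    ring

theorem mem_eval_pair {cf cg : Code} {x y : ℕ} :
    y ∈ (Code.pair cf cg).eval x ↔ ∃ a ∈ cf.eval x, ∃ b ∈ cg.eval x, Nat.pair a b = y := by
  simp only [Code.eval]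
  refine Part.mem_bind_iff.trans ?_
  simp

theorem mem_eval_rfind' {cf : Code} {a m y : ℕ} :
    y ∈ (Code.rfind' cf).eval (Nat.pair a m) ↔
      ∃ n, (0 ∈ cf.eval (Nat.pair a (n + m)) ∧
        ∀ i < n, ∃ v, v + 1 ∈ cf.eval (Nat.pair a (i + m))) ∧ n + m = y := by
  simp only [Code.eval, Nat.unpaired, Nat.unpair_pair]
  refine (Part.mem_map_iff _).trans (exists_congr fun n => and_congr_left fun _ => ?_)
  refine Nat.mem_rfind.trans (and_congr ?_ (forall₂_congr fun i _ => ?_))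
  · simp
  · simp only [Part.map_eq_map, Part.mem_map_iff, decide_eq_false_iff_not]
    exact ⟨fun ⟨v, hv, h0⟩ => ⟨v - 1, by rwa [Nat.sub_add_cancel (Nat.pos_of_ne_zero h0)]⟩,
      fun ⟨v, hv⟩ => ⟨v + 1, hv, v.succ_ne_zero⟩⟩

theorem mem_eval_rfind'_of_succ {cf : Code} {a m v y : ℕ}
    (h : v + 1 ∈ cf.eval (Nat.pair a m))
    (hy : y ∈ (Code.rfind' cf).eval (Nat.pair a (m + 1))) :
    y ∈ (Code.rfind' cf).eval (Nat.pair a m) := by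
  rw [mem_eval_rfind'] at hy ⊢
  obtain ⟨n, ⟨h0, hlt⟩, rfl⟩ := hy
  refine ⟨n + 1, ⟨by rwa [Nat.add_right_comm n 1 m], ?_⟩, by omega⟩
  rintro (_ | i) hi
  · exact ⟨v, by rwa [Nat.zero_add]⟩
  · rw [Nat.add_right_comm i 1 m]
    exact hlt i (by omega)

theorem holds_standard_of_mem_arithClauses {C : HornClause 9} (hC : C ∈ arithClauses)
    {ν : Fin 10 → ℕ} (hν : ν 0 = 0) : C.Holds standard ν := by
  simp only [arithClauses, List.mem_cons, List.not_mem_nil, or_false] at hC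
  rcases hC with rfl | rfl | rfl | rfl | rfl | rfl | rfl | rfl | rfl | rfl | rfl | rfl <;>
    simp only [HornClause.Holds, HornAtom.Holds, List.forall_mem_cons, List.not_mem_nil,
      IsEmpty.forall_iff, implies_true, standard_succ, standard_lt, standard_fst, standard_snd, hν,
      Nat.unpair_zero, Prod.fst_zero, Prod.snd_zero]
    <;>
    grind [unpair_add_one]

theorem holds_standard_of_mem_evalClauses {c : Code} {C : HornClause 9} (hC : C ∈ evalClauses c)
    {ν : Fin 10 → ℕ} (hν : ν 0 = 0) : C.Holds standard ν := by
  have pair_eq : ∀ {e a b : ℕ}, a = e.unpair.1 → b = e.unpair.2 → e = Nat.pair a b := by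
    rintro e _ _ rfl rfl
    exact (Nat.pair_unpair e).symm
  induction c with
  | zero =>
    obtain rfl := List.mem_singleton.1 hC
    simp [HornClause.Holds, HornAtom.Holds, hν, Code.eval, pure, PFun.pure]
  | succ =>
    obtain rfl := List.mem_singleton.1 hC
    simp [HornClause.Holds, HornAtom.Holds, Code.eval]
  | left =>
    obtain rfl := List.mem_singleton.1 hC
    simp [HornClause.Holds, HornAtom.Holds, Code.eval]
  | right =>
    obtain rfl := List.mem_singleton.1 hC
    simp [HornClause.Holds, HornAtom.Holds, Code.eval]
  | pair cf cg ihf ihg =>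
    simp only [evalClauses, List.mem_cons, List.mem_append] at hC
    rcases hC with rfl | hC | hC
    · simp only [HornClause.Holds, HornAtom.Holds, List.forall_mem_cons, List.not_mem_nil,
        IsEmpty.forall_iff, implies_true, standard_fst, standard_snd, standard_eval]
      rintro ⟨hf, hg, h₁, h₂, -⟩
      exact mem_eval_pair.2 ⟨_, hf, _, hg, (pair_eq h₁ h₂).symm⟩
    · exact ihf hC
    · exact ihg hC
  | comp cf cg ihf ihg =>
    simp only [evalClauses, List.mem_cons, List.mem_append] at hC
    rcases hC with rfl | hC | hC
    · simp only [HornClause.Holds, HornAtom.Holds, List.forall_mem_cons, List.not_mem_nil,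
        IsEmpty.forall_iff, implies_true, standard_eval]
      rintro ⟨hg, hf, -⟩
      exact Part.mem_bind hg hf
    · exact ihf hC
    · exact ihg hC
  | prec cf cg ihf ihg =>
    simp only [evalClauses, List.mem_cons, List.mem_append] at hC
    rcases hC with rfl | rfl | hC | hC
    · simp only [HornClause.Holds, HornAtom.Holds, List.forall_mem_cons, List.not_mem_nil,
        IsEmpty.forall_iff, implies_true, standard_fst, standard_snd, standard_eval, hν]
      rintro ⟨h₁, h₂, hf, -⟩
      rwa [pair_eq h₁ h₂, Code.eval_prec_zero]
    · simp only [HornClause.Holds, HornAtom.Holds, List.forall_mem_cons, List.not_mem_nil,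
        IsEmpty.forall_iff, implies_true, standard_succ, standard_fst, standard_snd,
        standard_eval]
      rintro ⟨h₁, h₂, h₃, h₄, h₅, hi, h₆, h₇, h₈, h₉, hg, -⟩
      rw [pair_eq h₄ h₅] at hi
      rw [pair_eq h₈ h₉, pair_eq h₆ h₇] at hg
      rw [pair_eq h₁ h₂, h₃, Code.eval_prec_succ cf cg (ν 3) (ν 5)]
      exact Part.mem_bind hi hg
    · exact ihf hC
    · exact ihg hC
  | rfind' cf ih =>
    simp only [evalClauses, List.mem_cons] at hC
    rcases hC with rfl | rfl | hC
    · simp only [HornClause.Holds, HornAtom.Holds, List.forall_mem_cons, List.not_mem_nil,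
        IsEmpty.forall_iff, implies_true, standard_snd, standard_eval, hν]
      rintro ⟨h₁, hf, -⟩
      rw [pair_eq rfl h₁] at hf ⊢
      exact mem_eval_rfind'.2 ⟨0, ⟨by rwa [Nat.zero_add], by simp⟩, Nat.zero_add _⟩
    · simp only [HornClause.Holds, HornAtom.Holds, List.forall_mem_cons, List.not_mem_nil,
        IsEmpty.forall_iff, implies_true, standard_succ, standard_fst, standard_snd,
        standard_eval]
      rintro ⟨h₁, h₂, hf, h₃, h₄, h₅, h₆, hr, -⟩
      rw [pair_eq h₁ h₂, h₃] at hf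
      rw [pair_eq h₅ h₆, h₄] at hr
      rw [pair_eq h₁ h₂]
      exact mem_eval_rfind'_of_succ hf hr
    · exact ih hC

theorem isHornModel_standard (c : Code) :
    IsHornModel (arithClauses ++ evalClauses c) standard :=
  ⟨fun _ => rfl, fun _ hC _ hν => (List.mem_append.1 hC).elim
    (holds_standard_of_mem_arithClauses · hν) (holds_standard_of_mem_evalClauses · hν)⟩

/-! ### Minimality of the intended interpretation -/

section Least

variable {B : ℕ → ℕ → ℕ → Prop}

theorem IsHornModel.lt (h : IsHornModel arithClauses B) {a b : ℕ} (hab : a < b) :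
    B ltRel a b := by
  have H := fun x₁ x₂ x₃ C hC => h.clauses C hC ![0, x₁, x₂, x₃, 0, 0, 0, 0, 0, 0] rfl
  simp [arithClauses, HornClause.Holds, HornAtom.Holds, forall_and] at H
  obtain ⟨h₁, h₂, -⟩ := H
  induction b, hab using Nat.le_induction with
  | base => exact h₁ _ _ (h.succ a)
  | succ b _ ih => exact h₂ _ _ _ ih (h.succ b)

theorem IsHornModel.unpair (h : IsHornModel arithClauses B) (e : ℕ) :
    B fstRel e e.unpair.1 ∧ B sndRel e e.unpair.2 := by
  have H := fun x₁ x₂ x₃ x₄ x₅ C hC =>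
    h.clauses C hC ![0, x₁, x₂, x₃, x₄, x₅, 0, 0, 0, 0] rfl
  simp [arithClauses, HornClause.Holds, HornAtom.Holds, forall_and] at H
  obtain ⟨-, -, h₀, h₀', h₁, h₁', h₂, h₂', h₃, h₃', h₄, h₄'⟩ := H
  induction e with
  | zero => simpa using ⟨h₀, h₀'⟩
  | succ e ih =>
    obtain ⟨hf, hg⟩ := ih
    have he := h.succ e
    rw [unpair_add_one]
    split_ifs with c₁ c₂ c₃
    · exact ⟨h₁ _ _ _ _ _ he hf hg (h.succ _) (h.lt c₁),
        h₁' _ _ _ _ _ he hf hg (h.succ _) (h.lt c₁)⟩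
    · have hs := h.succ e.unpair.1
      rw [c₂] at hs
      exact ⟨h₂ _ _ _ _ he hf hg hs, h₂' _ _ _ _ he hf hg hs⟩
    · exact ⟨h₃ _ _ _ _ _ he hf hg (h.lt c₃) (h.succ _),
        h₃' _ _ _ _ _ he hf hg (h.lt c₃) (h.succ _)⟩
    · rw [show e.unpair.2 = e.unpair.1 by omega] at hg
      exact ⟨h₄ _ _ _ _ he hf hg (h.succ _), h₄' _ _ _ _ he hf hg (h.succ _)⟩

theorem IsHornModel.holds {c : Code} (h : IsHornModel (arithClauses ++ evalClauses c) B)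
    {C : HornClause 9} (hC : C ∈ evalClauses c) (x₁ x₂ x₃ x₄ x₅ x₆ x₇ x₈ x₉ : ℕ) :
    C.Holds B ![0, x₁, x₂, x₃, x₄, x₅, x₆, x₇, x₈, x₉] :=
  h.clauses C (List.mem_append_right _ hC) _ rfl

/-- Every model of the program contains all true statements `c.eval a = b`. -/
theorem IsHornModel.eval {c : Code} (h : IsHornModel (arithClauses ++ evalClauses c) B)
    {a b : ℕ} (hab : b ∈ c.eval a) : B (evalRel c) a b := by
  have harith : IsHornModel arithClauses B := h.mono (by simp)
  have hfst : ∀ a b, B fstRel (Nat.pair a b) a := fun a b => by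
    simpa using (harith.unpair (Nat.pair a b)).1
  have hsnd : ∀ a b, B sndRel (Nat.pair a b) b := fun a b => by
    simpa using (harith.unpair (Nat.pair a b)).2
  induction c generalizing a b with
  | zero =>
    have H := h.holds List.mem_cons_self a 0 0 0 0 0 0 0 0
    simp [HornClause.Holds, HornAtom.Holds] at H
    simp [Code.eval, pure, PFun.pure] at hab
    exact hab ▸ H
  | succ =>
    have H := h.holds List.mem_cons_self a b 0 0 0 0 0 0 0
    simp [HornClause.Holds, HornAtom.Holds] at H
    simp [Code.eval] at hab
    exact H (hab ▸ h.succ a)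
  | left =>
    have H := h.holds List.mem_cons_self a b 0 0 0 0 0 0 0
    simp [HornClause.Holds, HornAtom.Holds] at H
    simp [Code.eval] at hab
    exact H (hab ▸ (harith.unpair a).1)
  | right =>
    have H := h.holds List.mem_cons_self a b 0 0 0 0 0 0 0
    simp [HornClause.Holds, HornAtom.Holds] at H
    simp [Code.eval] at hab
    exact H (hab ▸ (harith.unpair a).2)
  | pair cf cg ihf ihg =>
    replace ihf := @ihf (h.mono (by simp [evalClauses]; grind))
    replace ihg := @ihg (h.mono (by simp [evalClauses]; grind))
    obtain ⟨u, hu, v, hv, rfl⟩ := mem_eval_pair.1 hab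
    have H := h.holds List.mem_cons_self a (Nat.pair u v) u v 0 0 0 0 0
    simp [HornClause.Holds, HornAtom.Holds] at H
    exact H (ihf hu) (ihg hv) (hfst _ _) (hsnd _ _)
  | comp cf cg ihf ihg =>
    replace ihf := @ihf (h.mono (by simp [evalClauses]; grind))
    replace ihg := @ihg (h.mono (by simp [evalClauses]; grind))
    obtain ⟨u, hu, hv⟩ := Part.mem_bind_iff.1 hab
    have H := h.holds List.mem_cons_self a b u 0 0 0 0 0 0
    simp [HornClause.Holds, HornAtom.Holds] at H
    exact H (ihg hu) (ihf hv)
  | prec cf cg ihf ihg =>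
    replace ihf := @ihf (h.mono (by simp [evalClauses]; grind))
    replace ihg := @ihg (h.mono (by simp [evalClauses]; grind))
    obtain ⟨x, n, rfl⟩ : ∃ x n, a = Nat.pair x n := ⟨_, _, (Nat.pair_unpair a).symm⟩
    induction n generalizing b with
    | zero =>
      rw [Code.eval_prec_zero] at hab
      have H := h.holds List.mem_cons_self (Nat.pair x 0) b x 0 0 0 0 0 0
      simp [HornClause.Holds, HornAtom.Holds] at H
      exact H (hfst _ _) (hsnd _ _) (ihf hab)
    | succ n ih =>
      rw [Code.eval_prec_succ cf cg x n] at hab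
      obtain ⟨i, hi, hb⟩ := Part.mem_bind_iff.1 hab
      have H := h.holds (List.mem_cons_of_mem _ List.mem_cons_self) (Nat.pair x (n + 1)) b x
        (n + 1) n (Nat.pair x n) i (Nat.pair n i) (Nat.pair x (Nat.pair n i))
      simp [HornClause.Holds, HornAtom.Holds] at H
      exact H (hfst _ _) (hsnd _ _) (h.succ n) (hfst _ _) (hsnd _ _) (ih hi) (hfst _ _)
        (hsnd _ _) (hfst _ _) (hsnd _ _) (ihg hb)
  | rfind' cf ih =>
    replace ih := @ih (h.mono (by simp [evalClauses]; grind))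
    obtain ⟨x, m, rfl⟩ : ∃ x m, a = Nat.pair x m := ⟨_, _, (Nat.pair_unpair a).symm⟩
    obtain ⟨n, ⟨h0, hlt⟩, rfl⟩ := mem_eval_rfind'.1 hab
    clear hab
    induction n generalizing m with
    | zero =>
      rw [Nat.zero_add] at h0 ⊢
      have H := h.holds List.mem_cons_self (Nat.pair x m) m 0 0 0 0 0 0 0
      simp [HornClause.Holds, HornAtom.Holds] at H
      exact H (hsnd _ _) (ih h0)
    | succ n ihn =>
      obtain ⟨v, hv⟩ := hlt 0 (by omega)
      rw [Nat.zero_add] at hv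
      have hnext := ihn (m + 1) (by rwa [Nat.add_right_comm, Nat.add_assoc] at h0)
        fun i hi => by
          have := hlt (i + 1) (by omega)
          rwa [Nat.add_right_comm, Nat.add_assoc] at this
      have H := h.holds (List.mem_cons_of_mem _ List.mem_cons_self) (Nat.pair x m) (n + 1 + m)
        x m (v + 1) v (m + 1) (Nat.pair x (m + 1)) 0
      simp [HornClause.Holds, HornAtom.Holds] at H
      refine H (hfst _ _) (hsnd _ _) (ih hv) (h.succ _) (h.succ _) (hfst _ _) (hsnd _ _) ?_
      rwa [Nat.add_right_comm, Nat.add_assoc]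

end Least

/-! ### The modal translation of a Horn program -/

variable {arity : ℕ → ℕ}

/-- The atom `Bᵢ(x, y)` is rendered as `□ⁱ P(x, y)`. -/
def HornAtom.toFormula (P : ℕ) (a : HornAtom k) : Formula arity :=
  box^[a.rel] (binAtom P a.fst a.snd)

/-- A clause as an iterated implication. -/
def HornClause.toFormula (P : ℕ) (C : HornClause k) : Formula arity :=
  C.body.foldr (fun a φ => imp (a.toFormula P) φ) (C.head.toFormula P)

/-- The conjunction of the clauses of a program, ending in a tautology. -/
def matrix (P : ℕ) (Γ : List (HornClause k)) : Formula arity :=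
  Γ.foldr (fun C φ => and (C.toFormula P) φ) (imp (binAtom P 0 0) (binAtom P 0 0))

/-- The conjunction of a tautology and the formulas `B₀(xᵢ, xᵢ₊₁)` for `i < n`. -/
def numerals (P : ℕ) : ℕ → Formula arity
  | 0 => imp (binAtom P 0 0) (binAtom P 0 0)
  | n + 1 => and (numerals P n) (binAtom P n (n + 1))

/-- At every world after one step each element has a `B₀`-successor, where `B₀` is evaluated
`k + 1` steps later: the distance matches that of `alls k`. -/
def totality (P k : ℕ) : Formula arity :=
  box (all 1 (ex 2 (box (box^[k] (binAtom P 1 2)))))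

/-- The part of `translation` that depends on the input: some world `k + 2` steps away satisfies
`numerals P n` and `¬ Bᵣ(xₙ, x₀)`. -/
def query (P k r n : ℕ) : Formula arity :=
  neg (box^[k + 2] (neg (and (numerals P n) (neg (box^[r] (binAtom P n 0))))))

/-- The formula saying that the program `Γ` has a model in which `Bᵣ(n, 0)` fails. -/
def translation (P : ℕ) (Γ : List (HornClause k)) (r n : ℕ) : Formula arity :=
  and (and (totality P k) (box (alls k (matrix P Γ)))) (query P k r n)

theorem isEBBA_clause (P : ℕ) (C : HornClause k) :
    IsEBBA (C.toFormula P : Formula arity) := by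
  obtain ⟨body, head⟩ := C
  induction body with
  | nil => exact (isEBBA_binAtom _ _ _).boxes _
  | cons a l ih => exact ((isEBBA_binAtom _ _ _).boxes _).imp ih

theorem isEBBA_matrix (P : ℕ) (Γ : List (HornClause k)) :
    IsEBBA (matrix P Γ : Formula arity) := by
  induction Γ with
  | nil => exact (isEBBA_binAtom _ _ _).imp (isEBBA_binAtom _ _ _)
  | cons C Γ ih => exact .and (isEBBA_clause P C) ih

theorem isEBBA_numerals (P n : ℕ) : IsEBBA (numerals P n : Formula arity) := by
  induction n with
  | zero => exact (isEBBA_binAtom _ _ _).imp (isEBBA_binAtom _ _ _)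
  | succ n ih => exact .and ih (isEBBA_binAtom _ _ _)

theorem isEBBA_translation (P : ℕ) (Γ : List (HornClause k)) (r n : ℕ) :
    IsEBBA (translation P Γ r n : Formula arity) :=
  .and (.and (.boxAll _ (.exBox _ ((isEBBA_binAtom _ _ _).boxes _)))
    (.box ((isEBBA_matrix P Γ).alls k)))
    (.neg (((isEBBA_numerals P n).and ((isEBBA_binAtom _ _ _).boxes _).neg).neg.boxes _))

/-! ### Truth of the translation -/

namespace Model

variable (M : Model arity)

/-- `v` can be reached from `w` in exactly `n` steps. -/
def Reach : ℕ → M.World → M.World → Prop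
  | 0, w, v => w = v
  | n + 1, w, v => ∃ u, M.R w u ∧ Reach n u v

variable {M}

theorem sat_boxes {n : ℕ} {w : M.World} {σ : ℕ → M.Dom} {φ : Formula arity} :
    M.Sat w σ (box^[n] φ) ↔ ∀ v, M.Reach n w v → M.Sat v σ φ := by
  induction n generalizing w with
  | zero => simp [Reach]
  | succ n ih =>
    rw [Function.iterate_succ_apply']
    simp only [Sat, ih, Reach]
    grind

theorem sat_imp {w : M.World} {σ : ℕ → M.Dom} {φ ψ : Formula arity} :
    M.Sat w σ (imp φ ψ) ↔ (M.Sat w σ φ → M.Sat w σ ψ) := by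
  simp [imp, Sat]

theorem sat_all {w : M.World} {σ : ℕ → M.Dom} {x : ℕ} {φ : Formula arity} :
    M.Sat w σ (all x φ) ↔ ∀ d ∈ M.δ w, M.Sat w (Function.update σ x d) φ := by
  simp [Sat]

variable (M) in
/-- The family of binary relations which `M` provides at the world `v`: the pair `(a, b)` is in the
`i`-th relation if `□ⁱ P(a, b)` is true at `v`. -/
def rels (P : ℕ) (v : M.World) (i : ℕ) (a b : M.Dom) : Prop :=
  ∀ u, M.Reach i v u → (fun j : Fin (arity P) => if j.val = 0 then a else b) ∈ M.ρ u P

theorem sat_boxes_binAtom {P i x y : ℕ} {v : M.World} {σ : ℕ → M.Dom} :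
    M.Sat v σ (box^[i] (binAtom P x y)) ↔ M.rels P v i (σ x) (σ y) := by
  rw [sat_boxes]
  simp only [rels, binAtom, Sat, apply_ite]

theorem sat_binAtom {P x y : ℕ} {v : M.World} {σ : ℕ → M.Dom} :
    M.Sat v σ (binAtom P x y) ↔ M.rels P v 0 (σ x) (σ y) :=
  sat_boxes_binAtom (i := 0)

theorem sat_clause {P : ℕ} {C : HornClause k} {v : M.World} {σ : ℕ → M.Dom} :
    M.Sat v σ (C.toFormula P) ↔ C.Holds (M.rels P v) (fun i => σ i) := by
  obtain ⟨body, head⟩ := C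
  induction body with
  | nil => simp [HornClause.toFormula, HornClause.Holds, HornAtom.toFormula, HornAtom.Holds,
      sat_boxes_binAtom]
  | cons a l ih =>
    simp only [HornClause.toFormula, HornClause.Holds, List.foldr_cons, sat_imp,
      List.forall_mem_cons] at ih ⊢
    rw [ih, HornAtom.toFormula, sat_boxes_binAtom, and_imp]
    rfl

theorem sat_matrix {P : ℕ} {Γ : List (HornClause k)} {v : M.World} {σ : ℕ → M.Dom} :
    M.Sat v σ (matrix P Γ) ↔ ∀ C ∈ Γ, C.Holds (M.rels P v) (fun i => σ i) := by
  induction Γ with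
  | nil => simp [matrix, sat_imp]
  | cons C Γ ih =>
    rw [List.forall_mem_cons, ← ih, ← sat_clause]
    rfl

theorem sat_numerals {P n : ℕ} {v : M.World} {σ : ℕ → M.Dom} :
    M.Sat v σ (numerals P n) ↔ ∀ i < n, M.rels P v 0 (σ i) (σ (i + 1)) := by
  induction n with
  | zero => simp [numerals, sat_imp]
  | succ n ih =>
    rw [numerals, Sat, ih, sat_binAtom, Nat.forall_lt_succ_right]

/-- Elements of the local domain of `w` may be substituted for the variables bound by `alls`. -/
theorem sat_of_sat_alls {φ : Formula arity} {w v : M.World} {σ d : ℕ → M.Dom}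
    (h : M.Sat w σ (alls k φ)) (hd : ∀ i, d i ∈ M.δ w) (hv : M.Reach (k + 1) w v) :
    M.Sat v (fun i => if 1 ≤ i ∧ i ≤ k then d i else σ i) φ := by
  induction k generalizing w σ with
  | zero =>
    obtain ⟨u, hu, rfl⟩ := hv
    convert h u hu using 2
    rw [if_neg (by omega)]
  | succ k ih =>
    obtain ⟨u, hu, hv⟩ := hv
    have hd' : ∀ i, d i ∈ M.δ u := fun i => M.δ_mono w u hu (hd i)
    convert ih (sat_all.1 (h u hu) _ (hd' (k + 1))) hd' hv using 2 with i
    grind [Function.update_apply]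

/-- If every assignment that agrees with `σ` at `x₀` satisfies `φ` at the worlds reached, then
`alls k φ` is satisfied. -/
theorem sat_alls {φ : Formula arity} {w : M.World} {σ : ℕ → M.Dom}
    (h : ∀ v, M.Reach (k + 1) w v → ∀ τ : ℕ → M.Dom, τ 0 = σ 0 → M.Sat v τ φ) :
    M.Sat w σ (alls k φ) := by
  induction k generalizing w σ with
  | zero => exact fun u hu => h u ⟨u, hu, rfl⟩ σ rfl
  | succ k ih =>
    intro u hu
    refine sat_all.2 fun d _ => ih fun v hv τ hτ => h v ⟨u, hu, hv⟩ τ ?_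
    rw [hτ, Function.update_of_ne (by omega)]

end Model

/-- A model of the translation yields a model of the program: the `i`-th relation is read off at a
single world, and the numbers are interpreted by a sequence of elements which starts with the
values of `x₀, …, xₙ` and continues by choosing successors. -/
theorem exists_isHornModel_of_satisfiable {P : ℕ} {Γ : List (HornClause k)} {r n : ℕ}
    (h : Satisfiable (translation P Γ r n : Formula arity)) :
    ∃ B, IsHornModel Γ B ∧ ¬ B r n 0 := by
  obtain ⟨M, w, σ, hσ, ⟨htot, hmat⟩, hq⟩ := h
  have hq' : ∃ v, M.Reach (k + 2) w v ∧ M.Sat v σ (numerals P n) ∧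
      ¬ M.rels P v r (σ n) (σ 0) := by
    simpa only [query, Model.Sat, Model.sat_boxes (n := k + 2), Model.sat_boxes_binAtom,
      not_forall, not_not, exists_prop] using hq
  obtain ⟨v, ⟨u, hu, hv⟩, hnum, hneg⟩ := hq'
  rw [Model.sat_numerals] at hnum
  have hσu : ∀ x, σ x ∈ M.δ u := fun x => M.δ_mono w u hu (hσ x)
  have hsucc : ∀ a ∈ M.δ u, ∃ b ∈ M.δ u, M.rels P v 0 a b := by
    intro a ha
    obtain ⟨b, hb, hab⟩ := Model.sat_all.1 (htot u hu) a ha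
    refine ⟨b, hb, ?_⟩
    rw [← Function.iterate_succ_apply' box, Model.sat_boxes] at hab
    simpa [Model.sat_binAtom] using hab v hv
  have := M.dom_nonempty
  choose! s hs hsR using hsucc
  -- `e` interprets the number `i` by the value of `xᵢ` for `i ≤ n`, and by choice beyond `n`
  let e : ℕ → M.Dom := fun i => Nat.rec (σ 0) (fun i a => if i < n then σ (i + 1) else s a) i
  have he : ∀ i, e (i + 1) = if i < n then σ (i + 1) else s (e i) := fun i => rfl
  have heσ : ∀ i ≤ n, e i = σ i := by
    rintro (_ | i) hi
    · rfl
    · rw [he, if_pos (by omega)]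
  have heδ : ∀ i, e i ∈ M.δ u := by
    intro i
    induction i with
    | zero => exact hσu 0
    | succ i ih =>
      rw [he]
      split_ifs
      exacts [hσu _, hs _ ih]
  refine ⟨fun i a b => M.rels P v i (e a) (e b), ⟨fun a => ?_, fun C hC ν hν => ?_⟩, ?_⟩
  · by_cases ha : a < n
    · rw [heσ a ha.le, heσ (a + 1) ha]
      exact hnum a ha
    · rw [he, if_neg ha]
      exact hsR _ (heδ a)
  · have := Model.sat_matrix.1 (Model.sat_of_sat_alls (hmat u hu)
      (d := fun i => if hi : i < k + 1 then e (ν ⟨i, hi⟩) else e 0) (by grind) hv) C hC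
    have hν' : (fun i : Fin (k + 1) => if 1 ≤ i.val ∧ i.val ≤ k then
        if hi : i.val < k + 1 then e (ν ⟨i, hi⟩) else e 0 else σ i) = fun i => e (ν i) := by
      funext i
      by_cases hi : i = 0
      · subst hi
        simp [hν, heσ]
      · have := Fin.pos_iff_ne_zero.2 hi
        grind
    rw [hν'] at this
    exact this
  · simpa only [heσ n le_rfl, heσ 0 (Nat.zero_le n)] using hneg

/-- The model on an infinite path of worlds `0, 1, 2, …` with constant domain `ℕ`, in which binary
symbols are interpreted at the world `m + i` by the relation `B i`. -/
abbrev pathModel (arity : ℕ → ℕ) (m : ℕ) (B : ℕ → ℕ → ℕ → Prop) : Model arity where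
  World := ℕ
  Dom := ℕ
  world_countable := inferInstance
  world_nonempty := inferInstance
  dom_countable := inferInstance
  dom_nonempty := inferInstance
  δ _ := Set.univ
  R w v := v = w + 1
  ρ w P := {a | ∀ h : arity P = 2, B (w - m) (a ⟨0, by omega⟩) (a ⟨1, by omega⟩)}
  δ_nonempty _ := Set.univ_nonempty
  δ_mono _ _ _ := subset_rfl
  ρ_local _ _ _ _ _ := Set.mem_univ _

theorem pathModel_reach {m : ℕ} {B : ℕ → ℕ → ℕ → Prop} {n w v : ℕ} :
    (pathModel arity m B).Reach n w v ↔ v = w + n := by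
  induction n generalizing w with
  | zero => exact eq_comm
  | succ n ih =>
    refine ⟨?_, fun h => ⟨w + 1, rfl, ih.2 (by omega)⟩⟩
    rintro ⟨u, rfl, hu⟩
    rw [ih.1 hu]
    omega

theorem pathModel_rels {P m : ℕ} (hP : arity P = 2) {B : ℕ → ℕ → ℕ → Prop} :
    (pathModel arity m B).rels P m = B := by
  funext i a b
  simp only [Model.rels, eq_iff_iff]
  refine ⟨fun h => ?_, fun h u hu => ?_⟩
  · simpa [pathModel, hP] using h (m + i : ℕ) (pathModel_reach.2 rfl)
  · rw [pathModel_reach] at hu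
    subst hu
    simpa [pathModel, hP] using h

theorem satisfiable_of_isHornModel {P : ℕ} (hP : arity P = 2) {Γ : List (HornClause k)} {r n : ℕ}
    {B : ℕ → ℕ → ℕ → Prop} (hB : IsHornModel Γ B) (hr : ¬ B r n 0) :
    Satisfiable (translation P Γ r n : Formula arity) := by
  refine ⟨pathModel arity (k + 2) B, (0 : ℕ), (id : ℕ → ℕ), fun _ => Set.mem_univ _,
    ⟨?_, ?_⟩, ?_⟩
  · rintro u rfl
    refine Model.sat_all.2 fun a _ => ⟨(a + 1 : ℕ), Set.mem_univ _, ?_⟩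
    rw [← Function.iterate_succ_apply' box, Model.sat_boxes]
    intro v hv
    obtain rfl : v = (k + 2 : ℕ) :=
      (pathModel_reach.1 hv).trans (show 0 + 1 + (k + 1) = k + 2 by omega)
    rw [Model.sat_binAtom, pathModel_rels hP]
    exact hB.succ a
  · rintro u rfl
    refine Model.sat_alls fun v hv τ hτ => ?_
    obtain rfl : v = (k + 2 : ℕ) :=
      (pathModel_reach.1 hv).trans (show 0 + 1 + (k + 1) = k + 2 by omega)
    rw [Model.sat_matrix, pathModel_rels hP]
    exact fun C hC => hB.clauses C hC _ hτ
  · simp only [query, Model.Sat, Model.sat_boxes (n := k + 2)]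
    intro h
    refine h (k + 2 : ℕ) (pathModel_reach.2 (by omega)) ⟨?_, ?_⟩
    · rw [Model.sat_numerals, pathModel_rels hP]
      exact fun i _ => hB.succ i
    · rw [Model.sat_boxes_binAtom, pathModel_rels hP]
      exact hr

/-! ### Computability of the translation -/

theorem code_binAtom {P : ℕ} (hP : arity P = 2) (x y : ℕ) :
    (binAtom P x y : Formula arity).code = Nat.pair 0 (Nat.pair P (Encodable.encode [x, y])) := by
  have : ∀ m, m = 2 → List.ofFn (fun i : Fin m => if i.val = 0 then x else y) = [x, y] := by
    rintro _ rfl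
    simp
  rw [binAtom, code, this _ hP]

section Primrec

variable {F G : ℕ → Formula arity}

theorem primrec_code_neg (hF : Primrec fun n => (F n).code) :
    Primrec fun n => (neg (F n)).code :=
  Primrec₂.natPair.comp (.const 1) hF

theorem primrec_code_and (hF : Primrec fun n => (F n).code) (hG : Primrec fun n => (G n).code) :
    Primrec fun n => (and (F n) (G n)).code :=
  Primrec₂.natPair.comp (.const 2) (Primrec₂.natPair.comp hF hG)

theorem primrec_code_boxes (hF : Primrec fun n => (F n).code) (m : ℕ) :
    Primrec fun n => (box^[m] (F n)).code := by
  induction m with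
  | zero => exact hF
  | succ m ih =>
    simp only [Function.iterate_succ_apply']
    exact Primrec₂.natPair.comp (.const 4) ih

theorem primrec_code_binAtom {P : ℕ} (hP : arity P = 2) {x y : ℕ → ℕ} (hx : Primrec x)
    (hy : Primrec y) : Primrec fun n => (binAtom P (x n) (y n) : Formula arity).code := by
  simp only [code_binAtom hP]
  exact Primrec₂.natPair.comp (.const 0) (Primrec₂.natPair.comp (.const P)
    (Primrec.encode.comp (Primrec.list_cons.comp hx (Primrec.list_cons.comp hy (.const [])))))

theorem primrec_code_numerals {P : ℕ} (hP : arity P = 2) :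
    Primrec fun n => (numerals P n : Formula arity).code := by
  have h : Primrec₂ fun n c : ℕ =>
      Nat.pair 2 (Nat.pair c (binAtom P n (n + 1) : Formula arity).code) :=
    Primrec₂.natPair.comp (.const 2) (Primrec₂.natPair.comp .snd
      ((primrec_code_binAtom hP .id .succ).comp .fst))
  refine (Primrec.nat_rec₁ (numerals P 0 : Formula arity).code h).of_eq fun n => ?_
  induction n with
  | zero => rfl
  | succ n ih =>
    simp only [ih]
    rfl

theorem primrec_code_translation {P : ℕ} (hP : arity P = 2) (Γ : List (HornClause k)) (r : ℕ) :
    Primrec fun n => (translation P Γ r n : Formula arity).code :=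
  primrec_code_and (.const _) (primrec_code_neg (primrec_code_boxes (primrec_code_neg
    (primrec_code_and (primrec_code_numerals hP) (primrec_code_neg
      (primrec_code_boxes (primrec_code_binAtom hP .id (.const 0)) r)))) (k + 2)))

end Primrec

/-- Some code returns `0` on the codes halting on input `0`, and nothing on other codes. -/
theorem exists_code_halting :
    ∃ c : Code, ∀ d : Code, 0 ∈ c.eval (Encodable.encode d) ↔ (d.eval 0).Dom := by
  have h : Partrec fun n : ℕ => ((Denumerable.ofNat Code n).eval 0).map fun _ => 0 :=
    (Code.eval_part.comp (Computable.ofNat Code) (Computable.const 0)).map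
      (Computable.const 0).to₂
  obtain ⟨c, hc⟩ := Code.exists_code.1 (Partrec.nat_iff.1 h)
  refine ⟨c, fun d => ?_⟩
  simp [hc, Part.dom_iff_mem]

/-- An algorithm for `L` would decide the halting problem. A single binary symbol suffices. -/
theorem not_satProblemDecidable {P : ℕ} (hP : arity P = 2) {L : Set (Formula arity)}
    (hL : EBBA arity ⊆ L) : ¬ SatProblemDecidable L := by
  rintro ⟨f, hf, hfL⟩
  obtain ⟨c, hc⟩ := exists_code_halting
  let φ : ℕ → Formula arity := translation P (arithClauses ++ evalClauses c) (evalRel c)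
  have hφ : ∀ d : Code, Satisfiable (φ (Encodable.encode d)) ↔ ¬ (d.eval 0).Dom := by
    refine fun d => ⟨fun h hd => ?_, fun hd => ?_⟩
    · obtain ⟨B, hB, hneg⟩ := exists_isHornModel_of_satisfiable h
      exact hneg (hB.eval ((hc d).2 hd))
    · refine satisfiable_of_isHornModel hP (isHornModel_standard c) ?_
      rwa [standard_eval, hc]
  choose g hg hgφ using fun n => hfL (φ n) (hL (isEBBA_translation _ _ _ _))
  have hcomp : Computable g :=
    (hf.comp (primrec_code_translation hP _ _).to_comp).of_eq_tot hg
  refine ComputablePred.halting_problem 0 (ComputablePred.computable_iff.2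
    ⟨fun d => !g (Encodable.encode d), Primrec.not.to_comp.comp (hcomp.comp Computable.encode), ?_⟩)
  funext d
  have := hgφ (Encodable.encode d)
  rw [hφ] at this
  simp [← Bool.not_eq_true, this]

end FOML

theorem mainTheorem2 (arity : ℕ → ℕ) (harity : Computable arity)
    (hunary : {P : ℕ | arity P = 1}.Infinite)
    (hbinary : ∃ P Q : ℕ, P ≠ Q ∧ arity P = 2 ∧ arity Q = 2)
    (L : Set (FOML.Formula arity)) (hL : FOML.EBBA arity ⊆ L) :
    ¬ FOML.SatProblemDecidable L := by
  obtain ⟨P, -, -, hP, -⟩ := hbinary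
  exact FOML.not_satProblemDecidable hP hL
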